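/- Let $\mathbb{F}=\mathbb{F}_q$ be a finite field of odd characteristic with $q$ elements, and let $\chi$ be the non-trivial quadratic character of $\mathbb{F}^\times$, extended to $\mathbb{F}$ by $\chi(0)=0$. For an integer $r\ge 0$ put $$\mathcal{M}_3(r;q)=\sum_{d}\Big(-\sum_{\theta\in\mathbb{F}}\chi(d(\theta))\Big)^{r},\qquad \mathcal{M}_4(r;q)=\sum_{d}\Big(-1-\sum_{\theta\in\mathbb{F}}\chi(d(\theta))\Big)^{r},$$ where $d$ runs over the monic square-free polynomials in $\mathbb{F}[x]$ of degree $3$, respectively of degree $4$. Then $$\mathcal{M}_4(r;q)=\begin{cases} q\,\mathcal{M}_3(r;q) & \text{if } r \text{ is even},\\ -\mathcal{M}_3(r+1;q) & \text{if } r \text{ is odd}.\end{cases}$$ -/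

import Mathlib

/-- The set of monic square-free polynomials of degree `k` over `F`. -/
def monicSquarefree (F : Type*) [Field F] (k : ℕ) : Set (Polynomial F) :=
  {d | d.Monic ∧ d.natDegree = k ∧ Squarefree d}

/-- Over a finite field there are only finitely many monic square-free polynomials of degree `k`. -/
theorem monicSquarefree_finite (F : Type*) [Field F] [Finite F] (k : ℕ) :
    (monicSquarefree F k).Finite := by
  have hfin : (Polynomial.degreeLT F (k + 1) : Set (Polynomial F)).Finite :=
    by
    have : Finite (Polynomial.degreeLT F (k + 1)) := Finite.of_equiv _ (Polynomial.degreeLTEquiv F (k + 1)).symm.toEquiv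
    exact Set.toFinite _
  refine hfin.subset ?_
  rintro d ⟨-, hd, -⟩
  rw [SetLike.mem_coe, Polynomial.mem_degreeLT]
  exact lt_of_le_of_lt Polynomial.degree_le_natDegree (by rw [hd]; exact_mod_cast Nat.lt_succ_self k)

/-- The moment-sum `M_k(r; q)`: the sum over the monic square-free `d ∈ F[x]` of degree `k` of
`(- ε - ∑_{θ ∈ F} χ(d(θ))) ^ r`, where `χ` is the quadratic character of `F` with `χ(0) = 0`, and
`ε` is `1` for even `k` and `0` for odd `k`. -/
noncomputable def momentSum (F : Type*) [Field F] [Fintype F] [DecidableEq F] (k r : ℕ) : ℤ :=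
  ∑ d ∈ (monicSquarefree_finite F k).toFinset,
    (-(if Even k then 1 else 0) - ∑ θ : F, quadraticChar F (d.eval θ)) ^ r

/-! Write S(d) for the character sum of d. Completing the fourth power puts each monic quartic
uniquely in the form of a translate by m of `depressedQuartic A B β`. That quartic is square-free
exactly when the cubic f = X³ + AX² + BX + β² is (`squarefree_depressedQuartic_iff`), and then S(f)
= 1 + S(quartic) (`sum_quadraticChar_monicCubic`). So quartics correspond to triples (m, f, β) with
β² = f(0), and counting m and β gives M₄(r) = q ∑ (1 + χ(f(0))) (-S(f))^r over square-free cubics f.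
Averaging the χ(f(0)) term over translations replaces q χ(f(0)) by S(f), so M₄(r) = q M₃(r) -
M₃(r+1) (`momentSum_four`). Odd moments of cubics vanish by quadratic twisting, which leaves one
term for each parity. -/

open Polynomial Finset

/-! ### Translation and root scaling of square-free polynomials. -/

section Translation

variable {F : Type*} [Field F]

theorem squarefree_taylor (r : F) {f : F[X]} (hf : Squarefree f) : Squarefree (taylor r f) := by
  intro x hx
  have h := map_dvd (taylorEquiv (-r)) hx
  rw [map_mul, ← coe_taylorEquiv, ← taylorEquiv_symm] at h
  change _ ∣ (taylorEquiv r).symm (taylorEquiv r f) at h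
  rw [AlgEquiv.symm_apply_apply] at h
  exact (isUnit_map_iff (taylorEquiv r).symm x).1 (hf _ h)

theorem taylor_mem_monicSquarefree (r : F) {k : ℕ} {f : F[X]} (hf : f ∈ monicSquarefree F k) :
    taylor r f ∈ monicSquarefree F k := by
  obtain ⟨hm, hd, hs⟩ := hf
  refine ⟨?_, by rw [natDegree_taylor, hd], squarefree_taylor r hs⟩
  rw [Monic, leadingCoeff_taylor]
  exact hm

theorem taylor_neg_taylor (r : F) (f : F[X]) : taylor (-r) (taylor r f) = f := by
  rw [taylor_taylor, neg_add_cancel, taylor_zero]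

theorem taylor_taylor_neg (r : F) (f : F[X]) : taylor r (taylor (-r) f) = f := by
  rw [taylor_taylor, add_neg_cancel, taylor_zero]

theorem scaleRoots_scaleRoots_inv {n : F} (hn : n ≠ 0) (f : F[X]) :
    (f.scaleRoots n).scaleRoots n⁻¹ = f := by
  rw [← scaleRoots_mul, mul_inv_cancel₀ hn, scaleRoots_one]

theorem scaleRoots_inv_scaleRoots {n : F} (hn : n ≠ 0) (f : F[X]) :
    (f.scaleRoots n⁻¹).scaleRoots n = f := by
  rw [← scaleRoots_mul, inv_mul_cancel₀ hn, scaleRoots_one]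

theorem squarefree_scaleRoots {n : F} (hn : n ≠ 0) {f : F[X]} (hf : Squarefree f) :
    Squarefree (f.scaleRoots n) := by
  intro x hx
  have h := scaleRoots_dvd (r := n⁻¹) _ _ hx
  rw [scaleRoots_scaleRoots_inv hn, mul_scaleRoots_of_noZeroDivisors] at h
  have hu := hf _ h
  rw [isUnit_iff_degree_eq_zero] at hu ⊢
  rwa [degree_scaleRoots] at hu

theorem scaleRoots_mem_monicSquarefree {n : F} (hn : n ≠ 0) {k : ℕ} {f : F[X]}
    (hf : f ∈ monicSquarefree F k) : f.scaleRoots n ∈ monicSquarefree F k :=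
  ⟨(monic_scaleRoots_iff n).2 hf.1, by rw [natDegree_scaleRoots, hf.2.1],
    squarefree_scaleRoots hn hf.2.2⟩

end Translation

/-! ### The quartic and its associated cubic. -/

section ResolventPair

variable {F : Type*} [Field F]

/-- The monic cubic with coefficients `A`, `B`, `E`. -/
noncomputable def monicCubic (A B E : F) : F[X] :=
  X ^ 3 + C A * X ^ 2 + C B * X + C E

/-- The quartic without cubic term whose associated genus one curve has Jacobian
`Z² = X³ + A X² + B X + β²`, the difference of its points at infinity being `(0, β)` up to sign. -/
noncomputable def depressedQuartic (A B β : F) : F[X] :=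
  (X ^ 2 - C A) ^ 2 - C (8 * β) * X - C (4 * B)

theorem monicCubic_monic (A B E : F) : (monicCubic A B E).Monic := by
  unfold monicCubic; monicity!

theorem natDegree_monicCubic (A B E : F) : (monicCubic A B E).natDegree = 3 := by
  unfold monicCubic; compute_degree!

theorem depressedQuartic_eq (A B β : F) : depressedQuartic A B β =
    X ^ 4 + C (-2 * A) * X ^ 2 + C (-8 * β) * X + C (A ^ 2 - 4 * B) := by
  simp only [depressedQuartic, map_sub, map_mul, map_pow, map_neg, map_ofNat]; ring

theorem depressedQuartic_monic (A B β : F) : (depressedQuartic A B β).Monic := by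
  rw [depressedQuartic_eq]; monicity!

theorem natDegree_depressedQuartic (A B β : F) : (depressedQuartic A B β).natDegree = 4 := by
  rw [depressedQuartic_eq]; compute_degree!

theorem eq_monicCubic {f : F[X]} (hm : f.Monic) (hd : f.natDegree = 3) :
    f = monicCubic (f.coeff 2) (f.coeff 1) (f.coeff 0) := by
  conv_lhs => rw [hm.as_sum, hd]
  simp only [Finset.sum_range_succ, Finset.sum_range_zero, monicCubic]
  ring

theorem monicCubic_coeffs (A B E : F) : (monicCubic A B E).coeff 2 = A ∧
    (monicCubic A B E).coeff 1 = B ∧ (monicCubic A B E).coeff 0 = E := by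
  simp [monicCubic, coeff_X, coeff_C, coeff_X_pow]

theorem taylor_depressedQuartic (m A B β : F) : taylor m (depressedQuartic A B β) =
    X ^ 4 + C (4 * m) * X ^ 3 + C (6 * m ^ 2 - 2 * A) * X ^ 2 +
      C (4 * m ^ 3 - 4 * A * m - 8 * β) * X + C ((m ^ 2 - A) ^ 2 - 8 * β * m - 4 * B) := by
  rw [taylor_apply]
  simp only [depressedQuartic, map_sub, map_mul, map_pow, map_ofNat, sub_comp, pow_comp, X_comp,
    C_comp, mul_comp, ofNat_comp]
  ring

theorem taylor_depressedQuartic_coeffs (m A B β : F) :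
    (taylor m (depressedQuartic A B β)).coeff 3 = 4 * m ∧
    (taylor m (depressedQuartic A B β)).coeff 2 = 6 * m ^ 2 - 2 * A ∧
    (taylor m (depressedQuartic A B β)).coeff 1 = 4 * m ^ 3 - 4 * A * m - 8 * β ∧
    (taylor m (depressedQuartic A B β)).coeff 0 = (m ^ 2 - A) ^ 2 - 8 * β * m - 4 * B := by
  rw [taylor_depressedQuartic]
  refine ⟨?_, ?_, ?_, ?_⟩ <;>
    simp only [coeff_add, coeff_C_mul, coeff_X_pow, coeff_X, coeff_C] <;> norm_num

theorem taylor_depressedQuartic_injective (h2 : (2 : F) ≠ 0) {m A B β m' A' B' β' : F}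
    (h : taylor m (depressedQuartic A B β) = taylor m' (depressedQuartic A' B' β')) :
    m = m' ∧ A = A' ∧ B = B' ∧ β = β' := by
  obtain ⟨h3, h4, h5, h6⟩ := taylor_depressedQuartic_coeffs m A B β
  obtain ⟨k3, k4, k5, k6⟩ := taylor_depressedQuartic_coeffs m' A' B' β'
  rw [h] at h3 h4 h5 h6
  rw [k3] at h3; rw [k4] at h4; rw [k5] at h5; rw [k6] at h6
  have e4 : (4 : F) ≠ 0 := by
    have : (4 : F) = 2 * 2 := by norm_num
    rw [this]; exact mul_ne_zero h2 h2
  have e8 : (8 : F) ≠ 0 := by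
    have : (8 : F) = 2 * 4 := by norm_num
    rw [this]; exact mul_ne_zero h2 e4
  have hm : m = m' := (mul_left_cancel₀ e4 h3).symm
  subst hm
  have hA : A = A' := mul_left_cancel₀ h2 (by linear_combination h4)
  subst hA
  have hβ : β = β' := mul_left_cancel₀ e8 (by linear_combination h5)
  subst hβ
  exact ⟨rfl, rfl, mul_left_cancel₀ e4 (by linear_combination h6), rfl⟩

theorem exists_eq_taylor_depressedQuartic (h2 : (2 : F) ≠ 0) {d : F[X]} (hm : d.Monic)
    (hd : d.natDegree = 4) : ∃ m A B β : F, d = taylor m (depressedQuartic A B β) := by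
  have e4 : (4 : F) ≠ 0 := by
    have : (4 : F) = 2 * 2 := by norm_num
    rw [this]; exact mul_ne_zero h2 h2
  have e8 : (8 : F) ≠ 0 := by
    have : (8 : F) = 2 * 4 := by norm_num
    rw [this]; exact mul_ne_zero h2 e4
  obtain ⟨m, hm3⟩ : ∃ m, d.coeff 3 = 4 * m := ⟨d.coeff 3 / 4, by field_simp⟩
  obtain ⟨A, hA⟩ : ∃ A, d.coeff 2 = 6 * m ^ 2 - 2 * A :=
    ⟨(6 * m ^ 2 - d.coeff 2) / 2, by field_simp; ring⟩
  obtain ⟨β, hβ⟩ : ∃ β, d.coeff 1 = 4 * m ^ 3 - 4 * A * m - 8 * β :=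
    ⟨(4 * m ^ 3 - 4 * A * m - d.coeff 1) / 8, by field_simp; ring⟩
  obtain ⟨B, hB⟩ : ∃ B, d.coeff 0 = (m ^ 2 - A) ^ 2 - 8 * β * m - 4 * B :=
    ⟨((m ^ 2 - A) ^ 2 - 8 * β * m - d.coeff 0) / 4, by field_simp; ring⟩
  refine ⟨m, A, B, β, ?_⟩
  rw [taylor_depressedQuartic, ← hm3, ← hA, ← hβ, ← hB]
  conv_lhs => rw [hm.as_sum, hd]
  simp only [Finset.sum_range_succ, Finset.sum_range_zero]
  ring

/-- Over a perfect field, a polynomial is squarefree iff it has no double root in the algebraic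
closure. -/
theorem squarefree_iff_forall_aeval [PerfectField F] (f : F[X]) : Squarefree f ↔
    ∀ a : AlgebraicClosure F, aeval a f ≠ 0 ∨ aeval a (derivative f) ≠ 0 := by
  rw [← PerfectField.separable_iff_squarefree]
  exact isCoprime_iff_aeval_ne_zero_of_isAlgClosed (k := F) (AlgebraicClosure F) f (derivative f)

/-- Double roots x and t correspond through x² - A = 2t and β = xt; both conditions then reduce to B
= t² - 2x²t. -/
theorem exists_double_root_iff {K : Type*} [Field K] [IsAlgClosed K] (h2 : (2 : K) ≠ 0)
    (A B β : K) :
    (∃ x : K, (x ^ 2 - A) ^ 2 - 8 * β * x - 4 * B = 0 ∧ 4 * x * (x ^ 2 - A) - 8 * β = 0) ↔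
    ∃ t : K, t ^ 3 + A * t ^ 2 + B * t + β ^ 2 = 0 ∧ 3 * t ^ 2 + 2 * A * t + B = 0 := by
  have e4 : (4 : K) ≠ 0 := by
    have : (4 : K) = 2 * 2 := by norm_num
    rw [this]; exact mul_ne_zero h2 h2
  constructor
  · rintro ⟨x, h1, h3⟩
    obtain ⟨t, ht⟩ : ∃ t, x ^ 2 - A = 2 * t := ⟨(x ^ 2 - A) / 2, by field_simp⟩
    obtain rfl : A = x ^ 2 - 2 * t := by linear_combination -ht
    have hβ : β = x * t :=
      mul_left_cancel₀ e4 (mul_left_cancel₀ h2 (by linear_combination -h3))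
    subst hβ
    have hB : B = t ^ 2 - 2 * x ^ 2 * t := mul_left_cancel₀ e4 (by linear_combination -h1)
    subst hB
    exact ⟨t, by ring, by ring⟩
  · rintro ⟨t, h1, h3⟩
    -- At t = 0 the relation β = xt does not determine x. Here B = β = 0, the quartic is (x² - A)²,
    -- and any square root of A works.
    by_cases ht : t = 0
    · subst ht
      have hB : B = 0 := by linear_combination h3
      have hβ : β = 0 := pow_eq_zero_iff two_ne_zero |>.1 (by linear_combination h1)
      obtain ⟨x, hx⟩ := IsAlgClosed.exists_pow_nat_eq A two_pos
      refine ⟨x, ?_, ?_⟩ <;> rw [hx, hβ] <;> simp [hB]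
    · obtain ⟨x, rfl⟩ : ∃ x, β = t * x := ⟨β / t, by field_simp⟩
      have hA : A = x ^ 2 - 2 * t :=
        mul_left_cancel₀ (pow_ne_zero 2 ht) (by linear_combination t * h3 - h1)
      subst hA
      have hB : B = t ^ 2 - 2 * x ^ 2 * t := by linear_combination h3
      subst hB
      exact ⟨x, by ring, by ring⟩

theorem squarefree_depressedQuartic_iff [PerfectField F] (h2 : (2 : F) ≠ 0) (A B β : F) :
    Squarefree (depressedQuartic A B β) ↔ Squarefree (monicCubic A B (β ^ 2)) := by
  have h2' : (2 : AlgebraicClosure F) ≠ 0 := by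
    have := (map_ne_zero (algebraMap F (AlgebraicClosure F))).2 h2
    rwa [map_ofNat] at this
  have key := exists_double_root_iff h2' (algebraMap F (AlgebraicClosure F) A)
    (algebraMap F _ B) (algebraMap F _ β)
  have e2 : algebraMap F (AlgebraicClosure F) 2 = 2 := map_ofNat _ 2
  have e3 : algebraMap F (AlgebraicClosure F) 3 = 3 := map_ofNat _ 3
  have e4 : algebraMap F (AlgebraicClosure F) 4 = 4 := map_ofNat _ 4
  have e8 : algebraMap F (AlgebraicClosure F) 8 = 8 := map_ofNat _ 8
  rw [squarefree_iff_forall_aeval, squarefree_iff_forall_aeval, ← not_iff_not]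
  push Not
  convert key using 5 with x x x x
  · simp [depressedQuartic, e4, e8]
  · simp [depressedQuartic, derivative_pow, e2, e8]
    ring
  · simp [monicCubic]
  · simp [monicCubic, derivative_pow, e2, e3]
    ring

theorem ne_zero_or_ne_zero_of_squarefree_monicCubic {A B β : F}
    (h : Squarefree (monicCubic A B (β ^ 2))) : β ≠ 0 ∨ B ≠ 0 := by
  by_contra! h0
  obtain ⟨rfl, rfl⟩ := h0
  refine not_isUnit_X (h X ⟨X + C A, ?_⟩)
  simp only [monicCubic, ne_eq, OfNat.ofNat_ne_zero, not_false_eq_true, zero_pow, map_zero]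
  ring

end ResolventPair

/-! ### Point counts on the two curves. -/

section Moments

variable {F : Type*} [Field F] [Fintype F] [DecidableEq F]

theorem card_sq_eq (hF : ringChar F ≠ 2) (a : F) :
    ((univ.filter fun x : F => x ^ 2 = a).card : ℤ) = quadraticChar F a + 1 := by
  rw [← quadraticChar_card_sqrts hF a]
  congr 2
  ext; simp

theorem sum_quadraticChar_eq_card (hF : ringChar F ≠ 2) (f : F → F) :
    ∑ x, quadraticChar F (f x) =
      ((univ.filter fun p : F × F => p.2 ^ 2 = f p.1).card : ℤ) - Fintype.card F := by
  have : ((univ.filter fun p : F × F => p.2 ^ 2 = f p.1).card : ℤ) =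
      ∑ x, ((univ.filter fun y : F => y ^ 2 = f x).card : ℤ) := by
    rw [← Nat.cast_sum]
    congr 1
    simp only [card_filter, Fintype.sum_prod_type]
  rw [this]
  simp [card_sq_eq hF, sum_add_distrib]

/-- The birational map is t = (x² - A - y)/2, z = tx - β. Away from t = 0 both curve equations
become B = tx² - At - t² - 2βx. -/
theorem card_affine_depressedQuartic_of_ne (h2 : (2 : F) ≠ 0) (A B β : F) :
    (univ.filter fun p : F × F => p.2 ^ 2 = (depressedQuartic A B β).eval p.1 ∧
      p.2 ≠ p.1 ^ 2 - A).card =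
    (univ.filter fun p : F × F => p.2 ^ 2 = (monicCubic A B (β ^ 2)).eval p.1 ∧
      p.1 ≠ 0).card := by
  have e4 : (4 : F) ≠ 0 := by
    have : (4 : F) = 2 * 2 := by norm_num
    rw [this]; exact mul_ne_zero h2 h2
  simp only [depressedQuartic, monicCubic, eval_add, eval_sub, eval_mul, eval_pow, eval_X, eval_C]
  refine card_nbij' (fun p => ((p.1 ^ 2 - A - p.2) / 2, (p.1 ^ 2 - A - p.2) / 2 * p.1 - β))
    (fun p => ((p.2 + β) / p.1, ((p.2 + β) / p.1) ^ 2 - A - 2 * p.1)) ?_ ?_ ?_ ?_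
  · rintro ⟨x, y⟩ h
    simp only [coe_filter, mem_univ, true_and, Set.mem_ofPred_eq] at h ⊢
    obtain ⟨t, ht⟩ : ∃ t, t = (x ^ 2 - A - y) / 2 := ⟨_, rfl⟩
    have hy : y = x ^ 2 - A - 2 * t := by rw [ht]; field_simp; ring
    rw [← ht]
    obtain ⟨h, hne⟩ := h
    rw [hy] at h hne
    have hB : B = t * x ^ 2 - A * t - t ^ 2 - 2 * β * x :=
      mul_left_cancel₀ e4 (by linear_combination h)
    refine ⟨by rw [hB]; ring, fun h0 => hne (by rw [h0]; ring)⟩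
  · rintro ⟨t, z⟩ h
    simp only [coe_filter, mem_univ, true_and, Set.mem_ofPred_eq] at h ⊢
    obtain ⟨h, ht⟩ := h
    obtain ⟨x, hx⟩ : ∃ x, x = (z + β) / t := ⟨_, rfl⟩
    have hz : z = t * x - β := by rw [hx]; field_simp; ring
    rw [← hx]
    rw [hz] at h
    have hB : B = t * x ^ 2 - A * t - t ^ 2 - 2 * β * x :=
      mul_left_cancel₀ ht (by linear_combination -h)
    refine ⟨by rw [hB]; ring, fun h0 => mul_ne_zero h2 ht (by linear_combination -h0)⟩
  · rintro ⟨x, y⟩ h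
    simp only [coe_filter, mem_univ, true_and, Set.mem_ofPred_eq] at h
    have hne : x ^ 2 - A - y ≠ 0 := fun h0 => h.2 (by linear_combination -h0)
    have hx : ((x ^ 2 - A - y) / 2 * x - β + β) / ((x ^ 2 - A - y) / 2) = x := by
      field_simp; ring
    ext
    · exact hx
    · simp only [hx]; field_simp; ring
  · rintro ⟨t, z⟩ h
    simp only [coe_filter, mem_univ, true_and, Set.mem_ofPred_eq] at h
    obtain ⟨-, ht⟩ := h
    ext
    · field_simp; ring
    · field_simp; ring

/-- On y = x² - A the quartic equation reduces to 2βx + B = 0, while t = 0 leaves z = ±β. The counts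
are 1 and 2 if β ≠ 0, and 0 and 1 if β = 0 ≠ B. -/
theorem card_affine_depressedQuartic_of_eq (h2 : (2 : F) ≠ 0) {A B β : F}
    (h : β ≠ 0 ∨ B ≠ 0) :
    (univ.filter fun p : F × F => p.2 ^ 2 = (depressedQuartic A B β).eval p.1 ∧
      ¬ p.2 ≠ p.1 ^ 2 - A).card + 1 =
    (univ.filter fun p : F × F => p.2 ^ 2 = (monicCubic A B (β ^ 2)).eval p.1 ∧
      ¬ p.1 ≠ 0).card := by
  have e4 : (4 : F) ≠ 0 := by
    have : (4 : F) = 2 * 2 := by norm_num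
    rw [this]; exact mul_ne_zero h2 h2
  have hR : (univ.filter fun p : F × F => p.2 ^ 2 = (monicCubic A B (β ^ 2)).eval p.1 ∧
      ¬ p.1 ≠ 0) = {(0, β), (0, -β)} := by
    ext ⟨t, z⟩
    simp only [monicCubic, eval_add, eval_mul, eval_pow, eval_X, eval_C, mem_filter, mem_univ,
      true_and, not_not, mem_insert, mem_singleton, Prod.mk.injEq]
    constructor
    · rintro ⟨h, rfl⟩
      have : z ^ 2 = β ^ 2 := by linear_combination h
      simpa using sq_eq_sq_iff_eq_or_eq_neg.1 this
    · rintro (⟨rfl, rfl⟩ | ⟨rfl, rfl⟩) <;> simp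
  rw [hR]
  by_cases hβ : β = 0
  · subst hβ
    simp only [neg_zero, insert_eq_of_mem, mem_singleton, card_singleton, add_eq_right,
      card_eq_zero, filter_eq_empty_iff, mem_univ, true_imp_iff]
    rintro ⟨x, y⟩ ⟨h1, h3⟩
    simp only [not_not] at h3
    simp only [depressedQuartic, eval_sub, eval_mul, eval_pow, eval_X, eval_C, h3] at h1
    have : 4 * B = 0 := by linear_combination h1
    simp_all
  · have hne : β ≠ -β := fun h0 => mul_ne_zero h2 hβ (by linear_combination h0)
    rw [card_pair (by simpa using hne), Nat.succ_inj (b := 1), card_eq_one]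
    refine ⟨(-B / (2 * β), (-B / (2 * β)) ^ 2 - A), ?_⟩
    ext ⟨x, y⟩
    simp only [depressedQuartic, eval_sub, eval_mul, eval_pow, eval_X, eval_C, mem_filter,
      mem_univ, true_and, not_not, mem_singleton, Prod.mk.injEq]
    have hx : x = -B / (2 * β) ↔ 2 * β * x + B = 0 := by
      rw [eq_div_iff (mul_ne_zero h2 hβ)]
      constructor <;> intro h <;> linear_combination h
    constructor
    · rintro ⟨h1, rfl⟩
      have hx' := hx.2 (mul_left_cancel₀ e4 (by linear_combination h1))
      exact ⟨hx', by rw [← hx']⟩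
    · rintro ⟨hx', rfl⟩
      rw [← hx']
      exact ⟨by linear_combination 4 * hx.1 hx', rfl⟩

theorem sum_quadraticChar_monicCubic (hF : ringChar F ≠ 2) {A B β : F} (h : β ≠ 0 ∨ B ≠ 0) :
    ∑ θ, quadraticChar F ((monicCubic A B (β ^ 2)).eval θ) =
      1 + ∑ θ, quadraticChar F ((depressedQuartic A B β).eval θ) := by
  have h2 : (2 : F) ≠ 0 := Ring.two_ne_zero hF
  rw [sum_quadraticChar_eq_card hF, sum_quadraticChar_eq_card hF,
    ← card_filter_add_card_filter_not (s := univ.filter fun p : F × F =>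
      p.2 ^ 2 = (monicCubic A B (β ^ 2)).eval p.1) (fun p => p.1 ≠ 0),
    ← card_filter_add_card_filter_not (s := univ.filter fun p : F × F =>
      p.2 ^ 2 = (depressedQuartic A B β).eval p.1) (fun p => p.2 ≠ p.1 ^ 2 - A)]
  simp only [filter_filter]
  rw [card_affine_depressedQuartic_of_ne h2, ← card_affine_depressedQuartic_of_eq h2 h]
  push_cast
  ring

/-! ### Averaging over translations, and the moment identities. -/

theorem sum_quadraticChar_taylor (m : F) (f : F[X]) :
    ∑ θ, quadraticChar F ((taylor m f).eval θ) = ∑ θ, quadraticChar F (f.eval θ) := by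
  simp only [taylor_eval]
  exact Equiv.sum_comp (Equiv.addRight m) fun θ => quadraticChar F (f.eval θ)

omit [DecidableEq F] in
theorem sum_monicSquarefree_taylor (k : ℕ) (m : F) (g : F[X] → ℤ) :
    ∑ f ∈ (monicSquarefree_finite F k).toFinset, g (taylor m f) =
      ∑ f ∈ (monicSquarefree_finite F k).toFinset, g f := by
  refine sum_nbij' (taylor m) (taylor (-m)) ?_ ?_ ?_ ?_ ?_
  · simpa using fun f hf => taylor_mem_monicSquarefree m hf
  · simpa using fun f hf => taylor_mem_monicSquarefree (-m) hf
  · exact fun f _ => taylor_neg_taylor m f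
  · exact fun f _ => taylor_taylor_neg m f
  · exact fun f _ => rfl

/-- Translating f by m preserves its character sum and turns f(0) into f(m); summing over m produces
one more factor of the character sum. -/
theorem card_mul_sum_quadraticChar_eval_zero (r : ℕ) :
    (Fintype.card F : ℤ) * ∑ f ∈ (monicSquarefree_finite F 3).toFinset,
      quadraticChar F (f.eval 0) * (-∑ θ : F, quadraticChar F (f.eval θ)) ^ r =
    -momentSum F 3 (r + 1) := by
  have h (m : F) := sum_monicSquarefree_taylor 3 m fun f =>
    quadraticChar F (f.eval 0) * (-∑ θ : F, quadraticChar F (f.eval θ)) ^ r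
  simp only [sum_quadraticChar_taylor] at h
  simp only [taylor_eval, zero_add] at h
  have h' := Fintype.sum_congr _ _ h
  rw [sum_const, card_univ, nsmul_eq_mul, sum_comm] at h'
  rw [← h', momentSum, ← sum_neg_distrib]
  refine sum_congr rfl fun f _ => ?_
  rw [← sum_mul, if_neg (by decide)]
  ring

/-- Monic squarefree quartics correspond to triples of a translation parameter, a monic
squarefree cubic `f` and a square root of `f(0)`. -/
theorem momentSum_four_eq_sum (hF : ringChar F ≠ 2) (r : ℕ) :
    momentSum F 4 r =
      ∑ p ∈ (univ : Finset F) ×ˢ (monicSquarefree_finite F 3).toFinset ×ˢ (univ : Finset F) with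
        p.2.2 ^ 2 = p.2.1.eval 0, (-∑ θ : F, quadraticChar F (p.2.1.eval θ)) ^ r := by
  have h2 : (2 : F) ≠ 0 := Ring.two_ne_zero hF
  have hcub {f : F[X]} {β : F} (hf : f ∈ monicSquarefree F 3) (hβ : β ^ 2 = f.eval 0) :
      f = monicCubic (f.coeff 2) (f.coeff 1) (β ^ 2) := by
    rw [hβ, ← coeff_zero_eq_eval_zero]
    exact eq_monicCubic hf.1 hf.2.1
  symm
  refine sum_bij (fun p _ => taylor p.1 (depressedQuartic (p.2.1.coeff 2) (p.2.1.coeff 1) p.2.2))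
    ?_ ?_ ?_ ?_
  · rintro ⟨m, f, β⟩ h
    simp only [mem_filter, mem_product, mem_univ, true_and, and_true, Set.Finite.mem_toFinset]
      at h ⊢
    refine taylor_mem_monicSquarefree m ⟨depressedQuartic_monic _ _ _,
      natDegree_depressedQuartic _ _ _, ?_⟩
    rw [squarefree_depressedQuartic_iff h2, ← hcub h.1 h.2]
    exact h.1.2.2
  · rintro ⟨m, f, β⟩ h ⟨m', f', β'⟩ h' heq
    simp only [mem_filter, mem_product, mem_univ, true_and, and_true, Set.Finite.mem_toFinset]
      at h h'
    obtain ⟨rfl, hA, hB, rfl⟩ := taylor_depressedQuartic_injective h2 heq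
    rw [hcub h.1 h.2, hcub h'.1 h'.2]
    simp only at hA hB
    rw [hA, hB]
  · intro d hd
    rw [Set.Finite.mem_toFinset] at hd
    obtain ⟨m, A, B, β, rfl⟩ := exists_eq_taylor_depressedQuartic h2 hd.1 hd.2.1
    obtain ⟨c2, c1, c0⟩ := monicCubic_coeffs A B (β ^ 2)
    refine ⟨⟨m, monicCubic A B (β ^ 2), β⟩, ?_, by simp only [c2, c1]⟩
    simp only [mem_filter, mem_product, mem_univ, true_and, and_true, Set.Finite.mem_toFinset]
    refine ⟨⟨monicCubic_monic _ _ _, natDegree_monicCubic _ _ _, ?_⟩,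
      by rw [← coeff_zero_eq_eval_zero, c0]⟩
    rw [← squarefree_depressedQuartic_iff h2, ← taylor_neg_taylor m (depressedQuartic A B β)]
    exact squarefree_taylor _ hd.2.2
  · rintro ⟨m, f, β⟩ h
    simp only [mem_filter, mem_product, mem_univ, true_and, and_true, Set.Finite.mem_toFinset] at h
    have hsq := h.1.2.2
    rw [hcub h.1 h.2] at hsq
    have hs := sum_quadraticChar_monicCubic hF (A := f.coeff 2)
      (ne_zero_or_ne_zero_of_squarefree_monicCubic hsq)
    rw [← hcub h.1 h.2] at hs
    simp only [sum_quadraticChar_taylor, hs]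
    rw [if_pos (by decide)]
    ring

theorem momentSum_four (hF : ringChar F ≠ 2) (r : ℕ) :
    momentSum F 4 r = (Fintype.card F : ℤ) * momentSum F 3 r - momentSum F 3 (r + 1) := by
  rw [momentSum_four_eq_sum hF, sum_filter, sum_product]
  rw [sub_eq_add_neg, ← card_mul_sum_quadraticChar_eval_zero, ← mul_add, momentSum,
    ← sum_add_distrib, ← nsmul_eq_mul, ← card_univ, ← sum_const]
  refine sum_congr rfl fun m _ => ?_
  rw [sum_product]
  refine sum_congr rfl fun f _ => ?_
  rw [← sum_filter]
  dsimp only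
  -- The number of β with β² = f(0) is χ(f(0)) + 1.
  rw [sum_const, nsmul_eq_mul, card_sq_eq hF, if_neg (by decide)]
  ring

/-- For a non-residue n, the cubic n³f(x/n) has the opposite character sum, since χ(n³) = -1. This
twist permutes the square-free cubics, so the odd moment equals its own negative. -/
theorem momentSum_three_of_odd (hF : ringChar F ≠ 2) {r : ℕ} (hr : Odd r) :
    momentSum F 3 r = 0 := by
  obtain ⟨n, hn⟩ := quadraticChar_exists_neg_one hF
  have hn0 : n ≠ 0 := by rintro rfl; simp at hn
  have htwist {f : F[X]} (hf : f ∈ monicSquarefree F 3) :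
      ∑ θ, quadraticChar F ((f.scaleRoots n).eval θ) = -∑ θ, quadraticChar F (f.eval θ) := by
    rw [← Equiv.sum_comp (Equiv.mulLeft₀ n hn0), ← sum_neg_distrib]
    refine sum_congr rfl fun θ _ => ?_
    rw [Equiv.mulLeft₀_apply, scaleRoots_eval_mul, hf.2.1, map_mul, map_pow, hn]
    ring
  suffices h : momentSum F 3 r = -momentSum F 3 r by linarith
  rw [momentSum, ← sum_neg_distrib]
  refine sum_nbij' (scaleRoots · n) (scaleRoots · n⁻¹) ?_ ?_ ?_ ?_ ?_
  · simpa using fun f hf => scaleRoots_mem_monicSquarefree hn0 hf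
  · simpa using fun f hf => scaleRoots_mem_monicSquarefree (inv_ne_zero hn0) hf
  · exact fun f _ => scaleRoots_scaleRoots_inv hn0 f
  · exact fun f _ => scaleRoots_inv_scaleRoots hn0 f
  · intro f hf
    rw [htwist (by simpa using hf), if_neg (by decide), ← hr.neg_pow]
    congr 1
    ring

end Moments

theorem mainTheorem12 {F : Type*} [Field F] [Fintype F] [DecidableEq F] (hF : ringChar F ≠ 2)
    (r : ℕ) :
    (Even r → momentSum F 4 r = (Fintype.card F : ℤ) * momentSum F 3 r) ∧
      (Odd r → momentSum F 4 r = -momentSum F 3 (r + 1)) := by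
  rw [momentSum_four hF]
  refine ⟨fun hr => ?_, fun hr => ?_⟩
  · rw [momentSum_three_of_odd hF hr.add_one, sub_zero]
  · rw [momentSum_three_of_odd hF hr, mul_zero, zero_sub]
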